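/- Let $\Omega\subset\mathbb R^3$ be open and let $r,s\in(1,\infty)$ with $1/r+1/s=1$. **Notation.** $\mathrm{mat}:\mathbb R^9\to\mathbb R^{3\times3}$ fills a matrix row by row and $\mathrm{vec}=\mathrm{mat}^{-1}$. For $a\in\mathbb R^3$, $\mathrm{smat}(a)$ is the skew-symmetric matrix with $\mathrm{smat}(a)x=a\times x$, and $\mathrm{axl}:\mathfrak{so}(3)\to\mathbb R^3$ is the inverse of $\mathrm{smat}$. For $A=(a_{ij})\in\mathbb R^{3\times3}$ put $$\mathrm{dvec}\,A=(a_{11},a_{22},a_{33})^\top,\quad \mathrm{skvec}\,A=(-a_{23},a_{13},-a_{12})^\top,\quad \mathrm{symvec}\,A=(a_{32},-a_{31},a_{21})^\top .$$ For $Y\in\mathbb R^{3\times3}$ with rows $y_1^\top,y_2^\top,y_3^\top$ and $S_n:=\mathrm{smat}(y_n)$ define the $9\times9$ matrices $$L_{\mathrm{diag},Y}=-\begin{bmatrix}S_1&0&0\\0&S_2&0\\0&0&S_3\end{bmatrix},\quad L_{\mathrm{skew},Y}=\begin{bmatrix}0&-S_3&S_2\\S_3&0&0\\0&0&0\end{bmatrix},\quad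 L_{\mathrm{sym},Y}=\begin{bmatrix}0&0&0\\0&0&-S_1\\-S_2&S_1&0\end{bmatrix},$$ and $L_Y:=L_{\mathrm{skew},Y}+L_{\mathrm{sym},Y}$. For a vector field $v$ in $\mathbb R^3$, $\hat\nabla v:=\mathrm{vec}\,\nabla v$, where the rows of $\nabla v$ are the (weak) gradients of the components of $v$. $\mathrm{Curl}$ of a matrix field is the row-wise curl in the sense of distributions, and $W^p(\mathrm{Curl};\Omega):=\{Y\in L^p(\Omega;\mathbb R^{3\times3}):\mathrm{Curl}\,Y\in L^p(\Omega;\mathbb R^{3\times3})\}$. **Lemma.** Let $X\in W^{1,r}(\Omega;\mathbb R^{3\times3})$ and $Y\in W^s(\mathrm{Curl};\Omega)$. Then $XY\in W^1(\mathrm{Curl};\Omega)$, the vector fields $\mathrm{dvec}\,X,\mathrm{skvec}\,X,\mathrm{symvec}\,X$ belong to $W^{1,r}(\Omega;\mathbb R^3)$, the fields $L_{\mathrm{diag},Y},L_{\mathrm{skew},Y},L_{\mathrm{sym},Y}$ belong to $L^s(\Omega;\mathbb R^{9\times9})$, and $$\mathrm{Curl}(XY)=\mathrm{mat}\big(L_{\mathrm{diag},Y}\hat\nabla\,\mathrm{dvec}\,X+L_{\mathrm{skew},Y}\hat\nabla\,\mathrm{skvec}\,X+L_{\mathrm{sym},Y}\hat\nabla\,\mathrm{symvec}\,X\big)+X\,\mathrm{Curl}\,Y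 .$$ If $X$ is skew-symmetric almost everywhere in $\Omega$, then $\mathrm{axl}\,X\in W^{1,r}(\Omega;\mathbb R^3)$ and $$\mathrm{Curl}(XY)=\mathrm{mat}\big(L_Y\hat\nabla\,\mathrm{axl}\,X\big)+X\,\mathrm{Curl}\,Y .$$ Moreover $\det L_Y=-2(\det Y)^3$ for every $Y\in\mathbb R^{3\times3}$; hence $L_Y$ is invertible whenever $Y$ is. -/

import Mathlib

open MeasureTheory
open scoped ContDiff

namespace NeffCurl

/-- The space `ℝ³`, on which the fields are defined. -/
abbrev E3 : Type := EuclideanSpace ℝ (Fin 3)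

/-- Real `3 × 3` matrices. -/
abbrev M3 : Type := Matrix (Fin 3) (Fin 3) ℝ

/-! ### Linear algebra -/

/-- `mat : ℝ⁹ → ℝ³ˣ³`, filling the matrix row by row
(`finProdFinEquiv (i, j)` is the index `3 * i + j`). -/
def mat (a : Fin 9 → ℝ) : M3 := Matrix.of fun i j => a (finProdFinEquiv (m := 3) (n := 3) (i, j))

/-- `vec : ℝ³ˣ³ → ℝ⁹`, the inverse of `mat`. -/
def vec (A : M3) : Fin 9 → ℝ := fun k =>
  A ((finProdFinEquiv (m := 3) (n := 3)).symm k).1 ((finProdFinEquiv (m := 3) (n := 3)).symm k).2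

theorem mat_eq (a : Fin 9 → ℝ) :
    mat a = !![a 0, a 1, a 2; a 3, a 4, a 5; a 6, a 7, a 8] := by
  ext i j
  fin_cases i <;> fin_cases j <;> rfl

theorem mat_vec (A : M3) : mat (vec A) = A := by
  ext i j
  simp [mat, vec]

theorem vec_mat (a : Fin 9 → ℝ) : vec (mat a) = a := by
  ext k
  simp only [mat, vec, Matrix.of_apply, Prod.mk.eta, Equiv.apply_symm_apply]

/-- The skew-symmetric matrix `smat a` with `smat a *ᵥ x = a × x`. -/
def smat (a : Fin 3 → ℝ) : M3 :=
  !![0, -a 2, a 1;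
     a 2, 0, -a 0;
     -a 1, a 0, 0]

/-- The axial vector of a skew-symmetric matrix: on `so(3)` this is the inverse of `smat`,
see `axl_smat` and `smat_axl`. (It is used for skew-symmetric matrices only.) -/
def axl (A : M3) : Fin 3 → ℝ := ![A 2 1, A 0 2, A 1 0]

/-- The diagonal entries. -/
def dvec (A : M3) : Fin 3 → ℝ := ![A 0 0, A 1 1, A 2 2]

/-- The entries above the diagonal, arranged and signed so that `skvec = axl` on `so(3)`. -/
def skvec (A : M3) : Fin 3 → ℝ := ![-A 1 2, A 0 2, -A 0 1]

/-- The entries below the diagonal, arranged and signed so that `symvec = axl` on `so(3)`. -/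
def symvec (A : M3) : Fin 3 → ℝ := ![A 2 1, -A 2 0, A 1 0]

theorem axl_smat (a : Fin 3 → ℝ) : axl (smat a) = a := by
  ext i
  fin_cases i <;> rfl

theorem smat_axl (A : M3) (hA : A.transpose = -A) : smat (axl A) = A := by
  have h : ∀ i j, A j i = -A i j := fun i j => congrFun (congrFun hA i) j
  ext i j
  fin_cases i <;> fin_cases j <;> simp [smat, axl] <;>
    linarith [h 0 0, h 1 1, h 2 2, h 0 1, h 0 2, h 1 2]

/-- The `9 × 9` matrix made of `3 × 3` blocks of size `3 × 3`. -/
def blocks (B : Matrix (Fin 3) (Fin 3) M3) : Matrix (Fin 9) (Fin 9) ℝ :=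
  Matrix.reindex (finProdFinEquiv (m := 3) (n := 3)) (finProdFinEquiv (m := 3) (n := 3))
    (Matrix.of fun p q : Fin 3 × Fin 3 => B p.1 q.1 p.2 q.2)

/-- `L_{diag,Y}`; here `Y n` is the `n`-th row of `Y`. -/
def Ldiag (Y : M3) : Matrix (Fin 9) (Fin 9) ℝ :=
  -blocks !![smat (Y 0), 0, 0;
             0, smat (Y 1), 0;
             0, 0, smat (Y 2)]

/-- `L_{skew,Y}`. -/
def Lskew (Y : M3) : Matrix (Fin 9) (Fin 9) ℝ :=
  blocks !![0, -smat (Y 2), smat (Y 1);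
            smat (Y 2), 0, 0;
            0, 0, 0]

/-- `L_{sym,Y}`. -/
def Lsym (Y : M3) : Matrix (Fin 9) (Fin 9) ℝ :=
  blocks !![0, 0, 0;
            0, 0, -smat (Y 0);
            -smat (Y 1), smat (Y 0), 0]

/-- `L_Y = L_{skew,Y} + L_{sym,Y}`. -/
def LY (Y : M3) : Matrix (Fin 9) (Fin 9) ℝ := Lskew Y + Lsym Y

/-! ### Function spaces and weak derivatives on an open set `Ω ⊆ ℝ³` -/

/-- `φ ∈ C_c^∞(Ω)`. -/
def IsTest (Ω : Set E3) (φ : E3 → ℝ) : Prop :=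
  ContDiff ℝ ∞ φ ∧ HasCompactSupport φ ∧ tsupport φ ⊆ Ω

/-- The classical partial derivative `∂ᵢ φ`. -/
noncomputable def pd (i : Fin 3) (φ : E3 → ℝ) (x : E3) : ℝ :=
  fderiv ℝ φ x (EuclideanSpace.single i 1)

/-- `g` is the weak partial derivative `∂ᵢ u` on `Ω`. -/
def HasWeakPartial (Ω : Set E3) (i : Fin 3) (u g : E3 → ℝ) : Prop :=
  LocallyIntegrableOn u Ω ∧ LocallyIntegrableOn g Ω ∧
    ∀ φ, IsTest Ω φ → ∫ x in Ω, u x * pd i φ x = -∫ x in Ω, g x * φ x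

/-- `J` is the weak Jacobian `∇v` on `Ω`: row `i` is the gradient of the component `v i`. -/
def HasWeakJacobian (Ω : Set E3) (v : E3 → Fin 3 → ℝ) (J : E3 → M3) : Prop :=
  ∀ i j, HasWeakPartial Ω j (fun x => v x i) (fun x => J x i j)

/-- `w = curl v` on `Ω` in the sense of distributions, i.e.
`w k = ∂ (k+1) (v (k+2)) - ∂ (k+2) (v (k+1))`, with indices modulo `3`.
(The individual derivatives of `v` need not be functions.) -/
def HasWeakCurlVec (Ω : Set E3) (v w : E3 → Fin 3 → ℝ) : Prop :=
  (∀ k, LocallyIntegrableOn (fun x => v x k) Ω) ∧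
  (∀ k, LocallyIntegrableOn (fun x => w x k) Ω) ∧
    ∀ k φ, IsTest Ω φ →
      ∫ x in Ω, (v x (k + 2) * pd (k + 1) φ x - v x (k + 1) * pd (k + 2) φ x)
        = -∫ x in Ω, w x k * φ x

/-- `Z = Curl Y` on `Ω` weakly: the weak `curl`, row by row. -/
def HasWeakCurl (Ω : Set E3) (Y Z : E3 → M3) : Prop :=
  ∀ l, HasWeakCurlVec Ω (fun x => Y x l) (fun x => Z x l)

/-- `F ∈ Lᵖ(Ω; ℝᵐˣⁿ)`. -/
def MemLpMat {m n : ℕ} (Ω : Set E3) (p : ENNReal) (F : E3 → Matrix (Fin m) (Fin n) ℝ) : Prop :=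
  ∀ i j, MemLp (fun x => F x i j) p (volume.restrict Ω)

/-- `u ∈ W^{1,p}(Ω)`. -/
def MemW1 (Ω : Set E3) (p : ENNReal) (u : E3 → ℝ) : Prop :=
  MemLp u p (volume.restrict Ω) ∧
    ∀ i, ∃ g, MemLp g p (volume.restrict Ω) ∧ HasWeakPartial Ω i u g

/-- `Y ∈ W^p(Curl; Ω; ℝ³ˣ³)`, i.e. `Y ∈ Lᵖ(Ω)` and `Curl Y ∈ Lᵖ(Ω)`. -/
def MemWCurl (Ω : Set E3) (p : ENNReal) (Y : E3 → M3) : Prop :=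
  MemLpMat Ω p Y ∧ ∃ Z, MemLpMat Ω p Z ∧ HasWeakCurl Ω Y Z

end NeffCurl

open NeffCurl

/-! The components of a curl are divergences: `(curl v)ₖ = div (v × eₖ)` in the sense of
distributions. Hence everything rests on the product rule `div (u F) = ∇u · F + u div F` for `F`
and `div F` in `Lᵖ` and `u ∈ W^{1,q}`, with `p` and `q` conjugate, that is, on testing `div F` with
the function `ψ = u φ`, where `φ` is a test function. To see that `ψ` is admissible, let
`H t = ∫ F · ∇ψ(· - t) + ∫ (div F) ψ(· - t)`. By Hölder's inequality `H` is continuous, and since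
the mollifications of `ψ` are test functions, `H` is orthogonal to every bump function supported
close to `0`. So `H 0 = 0`. The rows of `X Y` are combinations of the rows of `Y`, and the formula
for `Curl (X Y)` becomes linear algebra.

For the determinant, `L_Y = ∑ₙ [eₙ]ₓ ⊗ [Yₙ]ₓ`, where `[y]ₓ` is the matrix of `y × ·` and `Yₙ` is
the `n`-th row of `Y`. The identity `M [y M]ₓ Mᵀ = det M • [y]ₓ`, applied with `M = Y` and `y = eₙ`,
gives `(1 ⊗ Y) L_Y (1 ⊗ Yᵀ) = det Y • L_1`, that is, `det Y ^ 6 * det L_Y = det Y ^ 9 * det L_1`.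
After an exchange of the two tensor factors of its rows, `L_1` is `v vᵀ - 1` with `v = vec 1`, so
`det L_1 = -2`. -/

namespace NeffCurl

open ContinuousLinearMap (mul mul_apply' lpPairing_eq_integral)
open scoped Convolution Matrix

theorem integral_indicator_mul {α : Type*} [MeasurableSpace α] {μ : Measure α} {S : Set α}
    (hS : MeasurableSet S) (f k : α → ℝ) :
    ∫ x, S.indicator f x * k x ∂μ = ∫ x in S, f x * k x ∂μ := by
  simp only [← integral_indicator hS, Set.indicator_mul_left]

section Translation

variable {E : Type*} [NormedAddCommGroup E] [MeasurableSpace E] [BorelSpace E] {μ : Measure E}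
  {p q : ENNReal} [p.HolderConjugate q] {f g η : E → ℝ}

theorem integrable_mul_sub [μ.IsAddRightInvariant] (hf : MemLp f p μ) (hg : MemLp g q μ) (t : E) :
    Integrable (fun x ↦ f x * g (x - t)) μ :=
  hf.integrable_mul (hg.comp_measurePreserving (measurePreserving_sub_right μ t))

variable [NormedSpace ℝ E] [FiniteDimensional ℝ E] [μ.IsAddHaarMeasure]

theorem continuous_integral_mul_sub_of_ne_top (hq : q ≠ ⊤) (hf : MemLp f p μ) (hg : MemLp g q μ) :
    Continuous fun t ↦ ∫ x, f x * g (x - t) ∂μ := by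
  have : Fact (1 ≤ p) := ⟨ENNReal.HolderConjugate.one_le p q⟩
  have : Fact (1 ≤ q) := ⟨ENNReal.HolderConjugate.one_le q p⟩
  let τ : C(E, C(E, E)) := (ContinuousMap.mk (fun a : E × E ↦ a.2 - a.1) (by fun_prop)).curry
  have hτ (t : E) : MeasurePreserving (τ t) μ μ := measurePreserving_sub_right μ t
  have pairing_eq (t : E) : ∫ x, f x * g (x - t) ∂μ =
      (mul ℝ ℝ).lpPairing μ p q (hf.toLp f)
        (Lp.compMeasurePreserving (τ t) (hτ t) (hg.toLp g)) := by
    rw [lpPairing_eq_integral]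
    refine integral_congr_ae ?_
    filter_upwards [hf.coeFn_toLp, Lp.coeFn_compMeasurePreserving (hg.toLp g) (hτ t),
      (hτ t).quasiMeasurePreserving.ae_eq_comp hg.coeFn_toLp] with x hfx hτx hgx
    rw [hfx, hτx, hgx]
    rfl
  simp only [pairing_eq]
  exact ((mul ℝ ℝ).lpPairing μ p q (hf.toLp f)).continuous.comp
    (continuous_const.compMeasurePreservingLp τ.continuous hτ hq)

theorem continuous_integral_mul_sub (hf : MemLp f p μ) (hg : MemLp g q μ) :
    Continuous fun t ↦ ∫ x, f x * g (x - t) ∂μ := by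
  rcases ne_or_eq q ⊤ with hq | rfl
  · exact continuous_integral_mul_sub_of_ne_top hq hf hg
  -- Translation is not continuous on `L^∞`, so it is moved to the factor in `L¹`.
  · have hp : p ≠ ⊤ := by
      rw [(ENNReal.HolderConjugate.eq_top_iff_eq_one ⊤ p).1 rfl]
      exact ENNReal.one_ne_top
    have swap (t : E) : ∫ x, f x * g (x - t) ∂μ = ∫ x, g x * f (x - -t) ∂μ := by
      rw [← integral_sub_right_eq_self (fun x ↦ g x * f (x - -t)) t]
      simp only [sub_neg_eq_add, sub_add_cancel, mul_comm]
    have : ENNReal.HolderConjugate ⊤ p := ENNReal.HolderTriple.symm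
    simp only [swap]
    exact (continuous_integral_mul_sub_of_ne_top hp hg hf).comp continuous_neg

theorem integrable_prod_mul_mul_sub (hf : MemLp f p μ) (hg : MemLp g q μ) (hη : Continuous η)
    (hηc : HasCompactSupport η) :
    Integrable (fun z : E × E ↦ f z.1 * (η z.2 * g (z.1 - z.2))) (μ.prod μ) := by
  have hmeas : AEStronglyMeasurable (fun z : E × E ↦ f z.1 * (η z.2 * g (z.1 - z.2)))
      (μ.prod μ) :=
    hf.1.comp_fst.mul (.convolution_integrand (mul ℝ ℝ) hη.aestronglyMeasurable hg.1)
  refine (integrable_prod_iff' hmeas).2 ⟨.of_forall fun t ↦ ?_, ?_⟩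
  · simpa only [mul_left_comm] using (integrable_mul_sub hf hg t).const_mul (η t)
  · have norm_eq (t : E) : ∫ x, ‖f x * (η t * g (x - t))‖ ∂μ =
        ‖η t‖ * ∫ x, ‖f x‖ * ‖g (x - t)‖ ∂μ := by
      simp only [norm_mul, mul_left_comm ‖f _‖, integral_const_mul]
    simp only [norm_eq]
    exact (hη.norm.mul
      (continuous_integral_mul_sub hf.norm hg.norm)).integrable_of_hasCompactSupport
        hηc.norm.mul_right

theorem integral_mul_convolution (hf : MemLp f p μ) (hg : MemLp g q μ) (hη : Continuous η)
    (hηc : HasCompactSupport η) :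
    ∫ x, f x * (g ⋆[mul ℝ ℝ, μ] η) x ∂μ = ∫ t, η t * ∫ x, f x * g (x - t) ∂μ ∂μ := by
  calc ∫ x, f x * (g ⋆[mul ℝ ℝ, μ] η) x ∂μ
      = ∫ x, ∫ t, f x * (η t * g (x - t)) ∂μ ∂μ := by
        simp only [convolution_eq_swap, mul_apply', integral_const_mul, mul_comm (g _)]
    _ = ∫ t, ∫ x, f x * (η t * g (x - t)) ∂μ ∂μ :=
        integral_integral_swap (integrable_prod_mul_mul_sub hf hg hη hηc)
    _ = ∫ t, η t * ∫ x, f x * g (x - t) ∂μ ∂μ := by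
        simp only [mul_left_comm (f _), integral_const_mul]

variable {S : Set E}

theorem continuous_setIntegral_mul_sub (hS : MeasurableSet S) (hf : MemLp f p (μ.restrict S))
    (hg : MemLp g q μ) : Continuous fun t ↦ ∫ x in S, f x * g (x - t) ∂μ := by
  simpa only [integral_indicator_mul hS f] using
    continuous_integral_mul_sub ((memLp_indicator_iff_restrict hS).2 hf) hg

theorem setIntegral_mul_convolution (hS : MeasurableSet S) (hf : MemLp f p (μ.restrict S))
    (hg : MemLp g q μ) (hη : Continuous η) (hηc : HasCompactSupport η) :
    ∫ x in S, f x * (g ⋆[mul ℝ ℝ, μ] η) x ∂μ = ∫ t, η t * ∫ x in S, f x * g (x - t) ∂μ ∂μ := by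
  simpa only [integral_indicator_mul hS f] using
    integral_mul_convolution ((memLp_indicator_iff_restrict hS).2 hf) hg hη hηc

end Translation

theorem eqOn_zero_of_forall_integral_contDiff_mul_eq_zero {E : Type*} [NormedAddCommGroup E]
    [NormedSpace ℝ E] [FiniteDimensional ℝ E] [MeasurableSpace E] [BorelSpace E] {μ : Measure E}
    [μ.IsOpenPosMeasure] [IsLocallyFiniteMeasure μ] {U : Set E} (hU : IsOpen U) {H : E → ℝ}
    (hH : Continuous H)
    (h : ∀ η : E → ℝ, ContDiff ℝ ∞ η → HasCompactSupport η → tsupport η ⊆ U →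
      ∫ t, η t * H t ∂μ = 0) : Set.EqOn H 0 U := by
  have ae_zero := hU.ae_eq_zero_of_integral_contDiff_smul_eq_zero
    (hH.locallyIntegrable.locallyIntegrableOn U) h
  exact Measure.eqOn_open_of_ae_eq ((ae_restrict_iff' hU.measurableSet).2 ae_zero) hU
    hH.continuousOn continuousOn_const

section WeakDerivatives

variable {Ω : Set E3} {p q : ENNReal} {i : Fin 3} {u u' g g' φ χ η : E3 → ℝ}
  {F G : E3 → Fin 3 → ℝ}

theorem pd_mul (hφ : ContDiff ℝ ∞ φ) (hχ : ContDiff ℝ ∞ χ) (x : E3) :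
    pd i (fun x ↦ φ x * χ x) x = φ x * pd i χ x + pd i φ x * χ x := by
  rw [pd, fderiv_fun_mul (hφ.differentiable (by simp) x) (hχ.differentiable (by simp) x)]
  simp only [pd, add_apply, smul_apply, smul_eq_mul, mul_comm (χ x)]

theorem IsTest.mul_contDiff (hφ : IsTest Ω φ) (hχ : ContDiff ℝ ∞ χ) :
    IsTest Ω fun x ↦ φ x * χ x :=
  ⟨hφ.1.mul hχ, hφ.2.1.mul_right, tsupport_mul_subset_left.trans hφ.2.2⟩

theorem IsTest.pd (hφ : IsTest Ω φ) (i : Fin 3) : IsTest Ω (pd i φ) :=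
  ⟨(hφ.1.fderiv_right (m := ∞) le_rfl).clm_apply contDiff_const, hφ.2.1.fderiv_apply ℝ _,
    (tsupport_fderiv_apply_subset ℝ _).trans hφ.2.2⟩

theorem IsTest.eq_zero_of_notMem (hφ : IsTest Ω φ) {x : E3} (hx : x ∉ Ω) : φ x = 0 :=
  image_eq_zero_of_notMem_tsupport fun h ↦ hx (hφ.2.2 h)

theorem IsTest.setIntegral_mul (hφ : IsTest Ω φ) (u : E3 → ℝ) :
    ∫ x in Ω, u x * φ x = ∫ x, u x * φ x :=
  setIntegral_eq_integral_of_forall_compl_eq_zero fun x hx ↦ by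
    rw [hφ.eq_zero_of_notMem hx, mul_zero]

theorem IsTest.integrable_mul (hφ : IsTest Ω φ) (hu : LocallyIntegrableOn u Ω) :
    Integrable fun x ↦ u x * φ x := by
  have on_tsupport : IntegrableOn (fun x ↦ u x * φ x) (tsupport φ) :=
    (hu.integrableOn_compact_subset hφ.2.2 hφ.2.1.isCompact).mul_continuousOn
      hφ.1.continuous.continuousOn hφ.2.1.isCompact
  exact (integrableOn_iff_integrable_of_support_subset
    ((Function.support_mul_subset_right u φ).trans (subset_tsupport φ))).1 on_tsupport

theorem IsTest.setIntegral_add_mul (hφ : IsTest Ω φ) (hu : LocallyIntegrableOn u Ω)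
    (hg : LocallyIntegrableOn g Ω) :
    ∫ x in Ω, (u x + g x) * φ x = (∫ x in Ω, u x * φ x) + ∫ x in Ω, g x * φ x := by
  simp only [add_mul]
  exact integral_add (hφ.integrable_mul hu).integrableOn (hφ.integrable_mul hg).integrableOn

theorem IsTest.setIntegral_dotProduct_mul (hφ : IsTest Ω φ)
    (hGF : ∀ i, LocallyIntegrableOn (fun x ↦ G x i * F x i) Ω) :
    ∫ x in Ω, G x ⬝ᵥ F x * φ x = ∑ i, ∫ x in Ω, G x i * F x i * φ x := by
  simp only [dotProduct, Finset.sum_mul]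
  exact integral_finsetSum _ fun i _ ↦ (hφ.integrable_mul (hGF i)).integrableOn

theorem IsTest.memLp_mul (hφ : IsTest Ω φ) (hΩ : MeasurableSet Ω)
    (hu : MemLp u p (volume.restrict Ω)) : MemLp (fun x ↦ u x * φ x) p := by
  obtain ⟨C, hC⟩ := hφ.1.continuous.bounded_above_of_compact_support hφ.2.1
  have hφ_top : MemLp φ ⊤ (volume.restrict Ω) :=
    memLp_top_of_bound hφ.1.continuous.aestronglyMeasurable C (.of_forall hC)
  have indicator_eq : Ω.indicator (fun x ↦ u x * φ x) = fun x ↦ u x * φ x :=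
    Set.indicator_eq_self.2 fun x hx ↦ by_contra fun hxΩ ↦
      hx (by simp only [hφ.eq_zero_of_notMem hxΩ, mul_zero])
  rw [← indicator_eq, memLp_indicator_iff_restrict hΩ]
  exact hφ_top.mul' hu

theorem ae_eq_of_forall_isTest (hΩ : IsOpen Ω) (hu : LocallyIntegrableOn u Ω)
    (hg : LocallyIntegrableOn g Ω)
    (h : ∀ φ, IsTest Ω φ → ∫ x in Ω, u x * φ x = ∫ x in Ω, g x * φ x) :
    u =ᵐ[volume.restrict Ω] g := by
  have sub_ae_zero : ∀ᵐ x, x ∈ Ω → (u - g) x = 0 :=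
    hΩ.ae_eq_zero_of_integral_contDiff_smul_eq_zero (hu.sub hg) fun φ hφ hφc hφΩ ↦ by
      have hφ : IsTest Ω φ := ⟨hφ, hφc, hφΩ⟩
      simp only [smul_eq_mul, Pi.sub_apply, mul_comm (φ _), sub_mul]
      rw [integral_sub (hφ.integrable_mul hu) (hφ.integrable_mul hg), sub_eq_zero,
        ← hφ.setIntegral_mul, ← hφ.setIntegral_mul, h φ hφ]
  filter_upwards [(ae_restrict_iff' hΩ.measurableSet).2 sub_ae_zero] with x hx
  exact sub_eq_zero.1 hx

theorem HasWeakPartial.ae_eq (hΩ : IsOpen Ω) (h : HasWeakPartial Ω i u g)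
    (h' : HasWeakPartial Ω i u g') : g =ᵐ[volume.restrict Ω] g' :=
  ae_eq_of_forall_isTest hΩ h.2.1 h'.2.1 fun φ hφ ↦
    neg_injective ((h.2.2 φ hφ).symm.trans (h'.2.2 φ hφ))

theorem HasWeakPartial.congr (h : HasWeakPartial Ω i u g) (hu : u =ᵐ[volume.restrict Ω] u') :
    HasWeakPartial Ω i u' g := by
  refine ⟨h.1.congr hu, h.2.1, fun φ hφ ↦ ?_⟩
  rw [← h.2.2 φ hφ]
  exact integral_congr_ae (hu.symm.mul .rfl)

theorem HasWeakPartial.neg (h : HasWeakPartial Ω i u g) :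
    HasWeakPartial Ω i (fun x ↦ -u x) fun x ↦ -g x :=
  ⟨h.1.neg, h.2.1.neg, fun φ hφ ↦ by simp only [neg_mul, integral_neg, h.2.2 φ hφ]⟩

theorem hasWeakPartial_zero : HasWeakPartial Ω i (fun _ ↦ 0) fun _ ↦ 0 :=
  ⟨locallyIntegrableOn_zero, locallyIntegrableOn_zero, fun φ _ ↦ by
    simp only [zero_mul, integral_zero, neg_zero]⟩

theorem MemW1.neg (h : MemW1 Ω p u) : MemW1 Ω p fun x ↦ -u x :=
  ⟨h.1.neg, fun i ↦
    have ⟨_, hg, hug⟩ := h.2 i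
    ⟨_, hg.neg, hug.neg⟩⟩

theorem MemW1.memLp_of_hasWeakPartial (hΩ : IsOpen Ω) (hu : MemW1 Ω p u)
    (hug : HasWeakPartial Ω i u g) : MemLp g p (volume.restrict Ω) :=
  have ⟨_, hg', hug'⟩ := hu.2 i
  hg'.ae_eq (hug'.ae_eq hΩ hug)

theorem HasWeakPartial.mul_isTest (h : HasWeakPartial Ω i u g) (hφ : IsTest Ω φ) :
    HasWeakPartial Set.univ i (fun x ↦ u x * φ x) fun x ↦ g x * φ x + u x * pd i φ x := by
  have hgφ := hφ.integrable_mul h.2.1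
  have hupd := (hφ.pd i).integrable_mul h.1
  refine ⟨(hφ.integrable_mul h.1).locallyIntegrable.locallyIntegrableOn _,
    (hgφ.add hupd).locallyIntegrable.locallyIntegrableOn _, fun χ hχ ↦ ?_⟩
  have hφχ : IsTest Ω fun x ↦ φ x * χ x := hφ.mul_contDiff hχ.1
  have hpdχ : IsTest Ω fun x ↦ pd i φ x * χ x := (hφ.pd i).mul_contDiff hχ.1
  simp only [Measure.restrict_univ]
  calc ∫ x, u x * φ x * pd i χ x
      = (∫ x, u x * pd i (fun x ↦ φ x * χ x) x) - ∫ x, u x * (pd i φ x * χ x) := by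
        rw [← integral_sub ((hφχ.pd i).integrable_mul h.1) (hpdχ.integrable_mul h.1)]
        simp only [pd_mul hφ.1 hχ.1, ← mul_sub, add_sub_cancel_right, mul_assoc]
    _ = -(∫ x, g x * (φ x * χ x)) - ∫ x, u x * (pd i φ x * χ x) := by
        rw [← (hφχ.pd i).setIntegral_mul, h.2.2 _ hφχ, hφχ.setIntegral_mul]
    _ = -∫ x, (g x * φ x + u x * pd i φ x) * χ x := by
        rw [← neg_add', ← integral_add (hφχ.integrable_mul h.2.1) (hpdχ.integrable_mul h.1)]
        simp only [add_mul, mul_assoc]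

theorem isTest_convolution {δ : ℝ} (hu : LocallyIntegrable u) (huc : HasCompactSupport u)
    (hδ : Metric.cthickening δ (tsupport u) ⊆ Ω) (hη : ContDiff ℝ ∞ η)
    (hηc : HasCompactSupport η) (hηδ : Function.support η ⊆ Metric.closedBall 0 δ) :
    IsTest Ω (u ⋆[mul ℝ ℝ, volume] η) := by
  refine ⟨hηc.contDiff_convolution_right (mul ℝ ℝ) hu hη, huc.convolution (mul ℝ ℝ) hηc, ?_⟩
  refine (closure_minimal ?_ Metric.isClosed_cthickening).trans hδ
  refine (support_convolution_subset (mul ℝ ℝ)).trans ?_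
  rintro _ ⟨x, hx, y, hy, rfl⟩
  refine Metric.mem_cthickening_of_dist_le _ x _ _ (subset_tsupport _ hx) ?_
  rw [dist_self_add_left]
  exact mem_closedBall_zero_iff.1 (hηδ hy)

theorem pd_comp_const_sub (hη : ContDiff ℝ ∞ η) (x t : E3) :
    pd i (fun t ↦ η (x - t)) t = -pd i η (x - t) := by
  have hasFDerivAt : HasFDerivAt (fun t ↦ η (x - t))
      ((fderiv ℝ η (x - t)).comp (-ContinuousLinearMap.id ℝ E3)) t :=
    ((hη.differentiable (by simp) (x - t)).hasFDerivAt).comp t ((hasFDerivAt_id t).const_sub x)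
  simp only [pd, hasFDerivAt.fderiv, ContinuousLinearMap.comp_apply, neg_apply,
    ContinuousLinearMap.id_apply, map_neg]

theorem HasWeakPartial.pd_convolution (h : HasWeakPartial Set.univ i u g) (hη : ContDiff ℝ ∞ η)
    (hηc : HasCompactSupport η) :
    pd i (u ⋆[mul ℝ ℝ, volume] η) = g ⋆[mul ℝ ℝ, volume] η := by
  ext x
  have hu : LocallyIntegrable u := locallyIntegrableOn_univ.1 h.1
  have hη' : ContDiff ℝ 1 η := hη.of_le (by exact_mod_cast le_top)
  have reflected_isTest : IsTest Set.univ fun t ↦ η (x - t) :=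
    ⟨hη.comp (contDiff_const.sub contDiff_id), hηc.comp_homeomorph (.subLeft x), Set.subset_univ _⟩
  calc pd i (u ⋆[mul ℝ ℝ, volume] η) x
      = ∫ t, u t * pd i η (x - t) := by
        rw [pd, (hηc.hasFDerivAt_convolution_right (mul ℝ ℝ) hu hη' x).fderiv,
          convolution_precompR_apply (mul ℝ ℝ) hu (hηc.fderiv ℝ)
            (hη'.continuous_fderiv one_ne_zero)]
        rfl
    _ = ∫ t, g t * η (x - t) := by
        have := h.2.2 _ reflected_isTest
        simpa only [Measure.restrict_univ, pd_comp_const_sub hη, mul_neg, integral_neg,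
          neg_inj] using this

end WeakDerivatives

section Divergence

/-- `g` is the weak gradient `∇u` on `Ω`. -/
def HasWeakGradient (Ω : Set E3) (u : E3 → ℝ) (g : E3 → Fin 3 → ℝ) : Prop :=
  ∀ i, HasWeakPartial Ω i u fun x ↦ g x i

/-- `d` is the divergence of the vector field `F` on `Ω` in the sense of distributions. (The
individual derivatives of `F` need not be functions.) -/
def HasWeakDiv (Ω : Set E3) (F : E3 → Fin 3 → ℝ) (d : E3 → ℝ) : Prop :=
  (∀ i, LocallyIntegrableOn (fun x ↦ F x i) Ω) ∧ LocallyIntegrableOn d Ω ∧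
    ∀ φ, IsTest Ω φ → ∑ i, ∫ x in Ω, F x i * pd i φ x = -∫ x in Ω, d x * φ x

variable {Ω : Set E3} {p q : ENNReal} {u d d' φ ψ η : E3 → ℝ} {g F F' G v v' w w' : E3 → Fin 3 → ℝ}

theorem HasWeakDiv.add (h : HasWeakDiv Ω F d) (h' : HasWeakDiv Ω F' d') :
    HasWeakDiv Ω (fun x ↦ F x + F' x) fun x ↦ d x + d' x := by
  refine ⟨fun i ↦ (h.1 i).add (h'.1 i), h.2.1.add h'.2.1, fun φ hφ ↦ ?_⟩
  simp only [Pi.add_apply]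
  rw [hφ.setIntegral_add_mul h.2.1 h'.2.1, neg_add, ← h.2.2 φ hφ, ← h'.2.2 φ hφ,
    ← Finset.sum_add_distrib]
  exact Finset.sum_congr rfl fun i _ ↦ (hφ.pd i).setIntegral_add_mul (h.1 i) (h'.1 i)

section SobolevTest

variable [p.HolderConjugate q] (hΩ : IsOpen Ω) (h : HasWeakDiv Ω F d)
  (hF : MemLp F p (volume.restrict Ω)) (hd : MemLp d p (volume.restrict Ω))
  (hψ : MemLp ψ q) (hG : MemLp G q) (hψG : HasWeakGradient Set.univ ψ G)
  (hψc : HasCompactSupport ψ)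
include hΩ h hF hd hψ hG hψG hψc

theorem HasWeakDiv.integral_mul_translates_eq_zero {δ : ℝ}
    (hδ : Metric.cthickening δ (tsupport ψ) ⊆ Ω) (hη : ContDiff ℝ ∞ η)
    (hηc : HasCompactSupport η) (hηδ : Function.support η ⊆ Metric.closedBall 0 δ) :
    ∫ t, η t * (∑ i, (∫ x in Ω, F x i * G (x - t) i) + ∫ x in Ω, d x * ψ (x - t)) = 0 := by
  have hm := hΩ.measurableSet
  have integrable_mul {H : E3 → ℝ} (hH : Continuous H) : Integrable fun t ↦ η t * H t :=
    (hη.continuous.mul hH).integrable_of_hasCompactSupport hηc.mul_right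
  have integrable_grad (i : Fin 3) :=
    integrable_mul (continuous_setIntegral_mul_sub hm (hF.eval i) (hG.eval i))
  have mollified_isTest : IsTest Ω (ψ ⋆[mul ℝ ℝ, volume] η) :=
    isTest_convolution (locallyIntegrableOn_univ.1 (hψG 0).1) hψc hδ hη hηc hηδ
  calc ∫ t, η t * (∑ i, (∫ x in Ω, F x i * G (x - t) i) + ∫ x in Ω, d x * ψ (x - t))
      = ∑ i, (∫ t, η t * ∫ x in Ω, F x i * G (x - t) i) +
          ∫ t, η t * ∫ x in Ω, d x * ψ (x - t) := by
        simp only [mul_add, Finset.mul_sum]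
        rw [integral_add (integrable_finsetSum _ fun i _ ↦ integrable_grad i)
          (integrable_mul (continuous_setIntegral_mul_sub hm hd hψ)),
          integral_finsetSum _ fun i _ ↦ integrable_grad i]
    _ = ∑ i, (∫ x in Ω, F x i * pd i (ψ ⋆[mul ℝ ℝ, volume] η) x) +
          ∫ x in Ω, d x * (ψ ⋆[mul ℝ ℝ, volume] η) x := by
        simp only [(hψG _).pd_convolution hη hηc,
          setIntegral_mul_convolution hm (hF.eval _) (hG.eval _) hη.continuous hηc,
          setIntegral_mul_convolution hm hd hψ hη.continuous hηc]
    _ = 0 := by rw [h.2.2 _ mollified_isTest, neg_add_cancel]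

theorem HasWeakDiv.sum_integral_mul_eq (hψΩ : tsupport ψ ⊆ Ω) :
    ∑ i, ∫ x in Ω, F x i * G x i = -∫ x in Ω, d x * ψ x := by
  obtain ⟨δ, hδ_pos, hδ⟩ := hψc.isCompact.exists_cthickening_subset_open hΩ hψΩ
  let H (t : E3) : ℝ := ∑ i, (∫ x in Ω, F x i * G (x - t) i) + ∫ x in Ω, d x * ψ (x - t)
  have hH : Continuous H :=
    (continuous_finsetSum _ fun i _ ↦
      continuous_setIntegral_mul_sub hΩ.measurableSet (hF.eval i) (hG.eval i)).add
      (continuous_setIntegral_mul_sub hΩ.measurableSet hd hψ)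
  have H_eqOn_zero : Set.EqOn H 0 (Metric.ball 0 δ) :=
    eqOn_zero_of_forall_integral_contDiff_mul_eq_zero Metric.isOpen_ball hH fun η hη hηc hηδ ↦
      h.integral_mul_translates_eq_zero hΩ hF hd hψ hG hψG hψc hδ hη hηc
        ((subset_tsupport η).trans (hηδ.trans Metric.ball_subset_closedBall))
  have H_zero : H 0 = 0 := H_eqOn_zero (Metric.mem_ball_self hδ_pos)
  simp only [H, sub_zero] at H_zero
  exact eq_neg_of_add_eq_zero_left H_zero

end SobolevTest

section ProductRule

variable [p.HolderConjugate q] (hΩ : IsOpen Ω) (h : HasWeakDiv Ω F d)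
  (hF : MemLp F p (volume.restrict Ω)) (hd : MemLp d p (volume.restrict Ω))
  (hu : MemLp u q (volume.restrict Ω)) (hg : MemLp g q (volume.restrict Ω))
  (hug : HasWeakGradient Ω u g)
include hΩ h hF hd hu hg hug

theorem HasWeakDiv.sum_integral_mul_isTest_eq (hφ : IsTest Ω φ) :
    ∑ i, ∫ x in Ω, F x i * (g x i * φ x + u x * pd i φ x) = -∫ x in Ω, d x * (u x * φ x) :=
  h.sum_integral_mul_eq hΩ hF hd (hφ.memLp_mul hΩ.measurableSet hu)
    (.of_eval fun i ↦ (hφ.memLp_mul hΩ.measurableSet (hg.eval i)).add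
      ((hφ.pd i).memLp_mul hΩ.measurableSet hu))
    (fun i ↦ (hug i).mul_isTest hφ) hφ.2.1.mul_left (tsupport_mul_subset_right.trans hφ.2.2)

theorem HasWeakDiv.smul :
    HasWeakDiv Ω (fun x ↦ u x • F x) fun x ↦ g x ⬝ᵥ F x + u x * d x := by
  have integrable_uF (i : Fin 3) : IntegrableOn (fun x ↦ u x * F x i) Ω :=
    hu.integrable_mul (hF.eval i)
  have integrable_gF (i : Fin 3) : IntegrableOn (fun x ↦ g x i * F x i) Ω :=
    (hg.eval i).integrable_mul (hF.eval i)
  have integrable_dot : IntegrableOn (fun x ↦ g x ⬝ᵥ F x) Ω :=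
    integrable_finsetSum _ fun i _ ↦ integrable_gF i
  have integrable_ud : IntegrableOn (fun x ↦ u x * d x) Ω := hu.integrable_mul hd
  refine ⟨fun i ↦ (integrable_uF i).locallyIntegrableOn,
    (integrable_dot.add integrable_ud).locallyIntegrableOn, fun φ hφ ↦ ?_⟩
  have hgφ (i : Fin 3) : IntegrableOn (fun x ↦ g x i * F x i * φ x) Ω :=
    (hφ.integrable_mul (integrable_gF i).locallyIntegrableOn).integrableOn
  have huφ (i : Fin 3) : IntegrableOn (fun x ↦ u x * F x i * pd i φ x) Ω :=
    ((hφ.pd i).integrable_mul (integrable_uF i).locallyIntegrableOn).integrableOn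
  calc ∑ i, ∫ x in Ω, u x * F x i * pd i φ x
      = ∑ i, (∫ x in Ω, F x i * (g x i * φ x + u x * pd i φ x)) -
          ∑ i, ∫ x in Ω, g x i * F x i * φ x := by
        rw [← Finset.sum_sub_distrib]
        refine Finset.sum_congr rfl fun i _ ↦ ?_
        rw [eq_sub_iff_add_eq', ← integral_add (hgφ i) (huφ i)]
        congr! 2 with x
        ring
    _ = -(∫ x in Ω, u x * d x * φ x) - ∫ x in Ω, g x ⬝ᵥ F x * φ x := by
        rw [h.sum_integral_mul_isTest_eq hΩ hF hd hu hg hug hφ,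
          hφ.setIntegral_dotProduct_mul fun i ↦ (integrable_gF i).locallyIntegrableOn]
        congr! 4 with x
        ring
    _ = -∫ x in Ω, (g x ⬝ᵥ F x + u x * d x) * φ x := by
        rw [hφ.setIntegral_add_mul integrable_dot.locallyIntegrableOn
          integrable_ud.locallyIntegrableOn, neg_add_rev, sub_eq_add_neg]

end ProductRule

theorem sum_integral_cross_single_mul (v : E3 → Fin 3 → ℝ) (a : Fin 3 → E3 → ℝ) (k : Fin 3)
    (S : Set E3) : ∑ i, ∫ x in S, (v x ⨯₃ Pi.single k 1) i * a i x =
      (∫ x in S, v x (k + 2) * a (k + 1) x) - ∫ x in S, v x (k + 1) * a (k + 2) x := by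
  fin_cases k <;>
    simp [Fin.sum_univ_three, cross_apply, integral_neg, sub_eq_add_neg, add_comm]

theorem locallyIntegrableOn_cross_single_iff :
    (∀ k i, LocallyIntegrableOn (fun x ↦ (v x ⨯₃ Pi.single k 1) i) Ω) ↔
      ∀ k, LocallyIntegrableOn (fun x ↦ v x k) Ω := by
  refine ⟨fun h k ↦ ?_, fun h k i ↦ ?_⟩
  · have := h (k + 1) (k + 2)
    fin_cases k <;> simpa [cross_apply] using this
  · have h' (k : Fin 3) : LocallyIntegrableOn (fun x ↦ -v x k) Ω := (h k).neg
    fin_cases k <;> fin_cases i <;>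
      simp [cross_apply, h, h', locallyIntegrableOn_zero]

theorem hasWeakCurlVec_iff_forall_hasWeakDiv :
    HasWeakCurlVec Ω v w ↔
      ∀ k, HasWeakDiv Ω (fun x ↦ v x ⨯₃ Pi.single k 1) fun x ↦ w x k := by
  have curl_eq (φ : E3 → ℝ) (hφ : IsTest Ω φ) (hv : ∀ k, LocallyIntegrableOn (fun x ↦ v x k) Ω)
      (k : Fin 3) : ∫ x in Ω, (v x (k + 2) * pd (k + 1) φ x - v x (k + 1) * pd (k + 2) φ x) =
        ∑ i, ∫ x in Ω, (v x ⨯₃ Pi.single k 1) i * pd i φ x := by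
    rw [sum_integral_cross_single_mul v (fun i ↦ pd i φ), integral_sub]
    exacts [((hφ.pd _).integrable_mul (hv _)).integrableOn,
      ((hφ.pd _).integrable_mul (hv _)).integrableOn]
  refine ⟨fun h k ↦ ?_, fun h ↦ ?_⟩
  · refine ⟨locallyIntegrableOn_cross_single_iff.2 h.1 k, h.2.1 k, fun φ hφ ↦ ?_⟩
    rw [← curl_eq φ hφ h.1, h.2.2 k φ hφ]
  · have hv := locallyIntegrableOn_cross_single_iff.1 fun k ↦ (h k).1
    refine ⟨hv, fun k ↦ (h k).2.1, fun k φ hφ ↦ ?_⟩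
    rw [curl_eq φ hφ hv, (h k).2.2 φ hφ]

theorem HasWeakCurlVec.add (h : HasWeakCurlVec Ω v w) (h' : HasWeakCurlVec Ω v' w') :
    HasWeakCurlVec Ω (fun x ↦ v x + v' x) fun x ↦ w x + w' x := by
  rw [hasWeakCurlVec_iff_forall_hasWeakDiv] at h h' ⊢
  intro k
  simpa only [map_add, LinearMap.add_apply, Pi.add_apply] using (h k).add (h' k)

theorem HasWeakCurlVec.smul [p.HolderConjugate q] (hΩ : IsOpen Ω) (h : HasWeakCurlVec Ω v w)
    (hv : MemLp v p (volume.restrict Ω)) (hw : MemLp w p (volume.restrict Ω))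
    (hu : MemLp u q (volume.restrict Ω)) (hg : MemLp g q (volume.restrict Ω))
    (hug : HasWeakGradient Ω u g) :
    HasWeakCurlVec Ω (fun x ↦ u x • v x) fun x ↦ g x ⨯₃ v x + u x • w x := by
  rw [hasWeakCurlVec_iff_forall_hasWeakDiv] at h ⊢
  intro k
  have hvk : MemLp (fun x ↦ v x ⨯₃ Pi.single k 1) p (volume.restrict Ω) :=
    (crossProduct.flip (Pi.single k (1 : ℝ))).toContinuousLinearMap.comp_memLp' hv
  have cross_apply_eq (x : E3) : (g x ⨯₃ v x) k = g x ⬝ᵥ v x ⨯₃ Pi.single k 1 := by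
    rw [triple_product_permutation, triple_product_permutation, single_one_dotProduct]
  simpa only [map_smul, LinearMap.smul_apply, Pi.add_apply, Pi.smul_apply, smul_eq_mul,
    cross_apply_eq] using (h k).smul hΩ hvk (hw.eval k) hu hg hug

theorem HasWeakCurlVec.ae_eq (hΩ : IsOpen Ω) (h : HasWeakCurlVec Ω v w)
    (h' : HasWeakCurlVec Ω v w') (k : Fin 3) :
    (fun x ↦ w x k) =ᵐ[volume.restrict Ω] fun x ↦ w' x k :=
  ae_eq_of_forall_isTest hΩ (h.2.1 k) (h'.2.1 k) fun φ hφ ↦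
    neg_injective ((h.2.2 k φ hφ).symm.trans (h'.2.2 k φ hφ))

end Divergence

open Matrix

section MatrixFields

variable {Ω : Set E3} {p q r : ENNReal} {X Y C : E3 → M3}
  {G : E3 → Matrix (Fin 3) (Fin 3) (Fin 3 → ℝ)}

theorem MemLpMat.memLp_row {m n : ℕ} {F : E3 → Matrix (Fin m) (Fin n) ℝ} (hF : MemLpMat Ω p F)
    (i : Fin m) : MemLp (fun x ↦ F x i) p (volume.restrict Ω) :=
  .of_eval (hF i)

theorem MemLpMat.mul [p.HolderTriple q r] {l m n : ℕ} {A : E3 → Matrix (Fin l) (Fin m) ℝ}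
    {B : E3 → Matrix (Fin m) (Fin n) ℝ} (hA : MemLpMat Ω p A) (hB : MemLpMat Ω q B) :
    MemLpMat Ω r fun x ↦ A x * B x := fun i j ↦ by
  simp only [mul_apply]
  exact memLp_finsetSum _ fun k _ ↦ (hB k j).mul' (hA i k)

theorem memLp_cross {α : Type*} [MeasurableSpace α] {μ : Measure α} [p.HolderTriple q r]
    {g v : α → Fin 3 → ℝ} (hg : MemLp g p μ) (hv : MemLp v q μ) :
    MemLp (fun x ↦ g x ⨯₃ v x) r μ := by
  have mul_memLp (i j : Fin 3) : MemLp (fun x ↦ g x i * v x j) r μ := (hv.eval j).mul' (hg.eval i)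
  refine .of_eval fun k ↦ ?_
  simp only [cross_apply]
  fin_cases k
  exacts [(mul_memLp 1 2).sub (mul_memLp 2 1), (mul_memLp 2 0).sub (mul_memLp 0 2),
    (mul_memLp 0 1).sub (mul_memLp 1 0)]

theorem HasWeakCurl.memLpMat (hΩ : IsOpen Ω) (hY : MemWCurl Ω p Y) (hC : HasWeakCurl Ω Y C) :
    MemLpMat Ω p C :=
  have ⟨_, _, hC', hYC'⟩ := hY
  fun l k ↦ (hC' l k).ae_eq ((hYC' l).ae_eq hΩ (hC l) k)

theorem hasWeakCurl_mul [p.HolderConjugate q] (hΩ : IsOpen Ω)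
    (hX : ∀ l n, MemW1 Ω q fun x ↦ X x l n)
    (hG : ∀ l n, HasWeakGradient Ω (fun x ↦ X x l n) fun x ↦ G x l n)
    (hY : MemWCurl Ω p Y) (hC : HasWeakCurl Ω Y C) :
    HasWeakCurl Ω (fun x ↦ X x * Y x)
      fun x ↦ of (fun l ↦ ∑ n, G x l n ⨯₃ Y x n) + X x * C x := by
  intro l
  have row_term (n : Fin 3) : HasWeakCurlVec Ω (fun x ↦ X x l n • Y x n)
      fun x ↦ G x l n ⨯₃ Y x n + X x l n • C x n :=
    (hC n).smul hΩ (hY.1.memLp_row n) ((hC.memLpMat hΩ hY).memLp_row n) (hX l n).1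
      (.of_eval fun i ↦ (hX l n).memLp_of_hasWeakPartial hΩ (hG l n i)) (hG l n)
  convert ((row_term 0).add (row_term 1)).add (row_term 2) using 2 with x x
  · change (X x * Y x) l = _
    rw [mul_apply_eq_vecMul, vecMul_eq_sum, Fin.sum_univ_three]
  · change (∑ n, G x l n ⨯₃ Y x n) + (X x * C x) l = _
    rw [mul_apply_eq_vecMul, vecMul_eq_sum, Fin.sum_univ_three, Fin.sum_univ_three]
    abel

theorem MemWCurl.mul [p.HolderConjugate q] (hΩ : IsOpen Ω)
    (hX : ∀ l n, MemW1 Ω q fun x ↦ X x l n) (hY : MemWCurl Ω p Y) :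
    MemWCurl Ω 1 fun x ↦ X x * Y x := by
  have : q.HolderTriple p 1 := .symm
  obtain ⟨C, hC, hYC⟩ := hY.2
  choose G hG hXG using fun l n ↦ (hX l n).2
  have hX' : MemLpMat Ω q X := fun l n ↦ (hX l n).1
  have cross_memLp (l n : Fin 3) :
      MemLp (fun x ↦ (fun i ↦ G l n i x) ⨯₃ Y x n) 1 (volume.restrict Ω) :=
    memLp_cross (.of_eval (hG l n)) (hY.1.memLp_row n)
  refine ⟨hX'.mul hY.1, _, fun l k ↦ ?_,
    hasWeakCurl_mul (G := fun x l n i ↦ G l n i x) hΩ hX hXG hY hYC⟩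
  have sum_memLp := (memLp_finsetSum Finset.univ fun n _ ↦ cross_memLp l n).eval k
  exact sum_memLp.add (hX'.mul hC l k)

end MatrixFields

section Formula

variable {Ω : Set E3} {p : ENNReal} {X Y D K S : E3 → M3}

theorem mat_blocks_mulVec_vec (B : Matrix (Fin 3) (Fin 3) M3) (A : M3) (i : Fin 3) :
    mat (blocks B *ᵥ vec A) i = ∑ j, B i j *ᵥ A j := by
  ext a
  simp only [mat, of_apply, mulVec, dotProduct, Finset.sum_apply]
  rw [← Equiv.sum_comp (finProdFinEquiv (m := 3) (n := 3)), Fintype.sum_prod_type]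
  simp only [blocks, vec, reindex_apply, submatrix_apply, of_apply, Equiv.symm_apply_apply]

theorem smat_mulVec (y z : Fin 3 → ℝ) : smat y *ᵥ z = y ⨯₃ z := by
  ext k
  fin_cases k <;> simp [smat, cross_apply, mulVec, dotProduct, Fin.sum_univ_three] <;> ring

/-- The gradients of the entries of a matrix field `X`, read off from the Jacobians `D`, `K`, `S`
of `dvec X`, `skvec X`, `symvec X`. -/
def entryGradient (D K S : M3) : Matrix (Fin 3) (Fin 3) (Fin 3 → ℝ) :=
  !![D 0, -K 2, K 1;
     S 2, D 1, -K 0;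
     -S 1, S 0, D 2]

theorem mat_mulVec_vec_eq_sum_cross (Y D K S : M3) :
    mat (Ldiag Y *ᵥ vec D + Lskew Y *ᵥ vec K + Lsym Y *ᵥ vec S) =
      of fun l ↦ ∑ n, entryGradient D K S l n ⨯₃ Y n := by
  have mat_add (a b : Fin 9 → ℝ) : mat (a + b) = mat a + mat b := rfl
  have mat_neg (a : Fin 9 → ℝ) : mat (-a) = -mat a := rfl
  ext l k
  simp only [Ldiag, Lskew, Lsym, neg_mulVec, mat_add, mat_neg, Matrix.add_apply,
    Matrix.neg_apply, of_apply, mat_blocks_mulVec_vec, Fin.sum_univ_three]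
  have neg_cross_apply (v w : Fin 3 → ℝ) : -(v ⨯₃ w) k = (w ⨯₃ v) k :=
    congrFun (cross_anticomm v w) k
  fin_cases l <;> simp [entryGradient, smat_mulVec, neg_mulVec, neg_cross_apply] <;> ring

theorem hasWeakGradient_entryGradient (hD : HasWeakJacobian Ω (fun x ↦ dvec (X x)) D)
    (hK : HasWeakJacobian Ω (fun x ↦ skvec (X x)) K)
    (hS : HasWeakJacobian Ω (fun x ↦ symvec (X x)) S) (l n : Fin 3) :
    HasWeakGradient Ω (fun x ↦ X x l n) fun x ↦ entryGradient (D x) (K x) (S x) l n := by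
  have of_neg {u : E3 → ℝ} {g : E3 → Fin 3 → ℝ} (h : HasWeakGradient Ω (fun x ↦ -u x) g) :
      HasWeakGradient Ω u fun x ↦ -g x := fun i ↦ by
    simpa only [neg_neg, Pi.neg_apply] using (h i).neg
  fin_cases l <;> fin_cases n
  exacts [hD 0, of_neg (hK 2), hK 1, hS 2, hD 1, of_neg (hK 0), of_neg (hS 1), hS 0, hD 2]

theorem HasWeakJacobian.congr {v v' : E3 → Fin 3 → ℝ} (h : HasWeakJacobian Ω v D)
    (hv : v =ᵐ[volume.restrict Ω] v') : HasWeakJacobian Ω v' D := fun i j ↦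
  (h i j).congr (hv.fun_comp (· i))

theorem dvec_eq_zero_of_transpose_eq_neg {A : M3} (hA : Aᵀ = -A) : dvec A = 0 := by
  have hA' (i j : Fin 3) : A j i = -A i j := congrFun₂ hA i j
  ext i
  fin_cases i
  exacts [self_eq_neg.1 (hA' 0 0), self_eq_neg.1 (hA' 1 1), self_eq_neg.1 (hA' 2 2)]

theorem skvec_eq_axl_of_transpose_eq_neg {A : M3} (hA : Aᵀ = -A) : skvec A = axl A := by
  have hA' (i j : Fin 3) : A j i = -A i j := congrFun₂ hA i j
  rw [skvec, axl, hA' 1 2, hA' 0 1]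

theorem symvec_eq_axl_of_transpose_eq_neg {A : M3} (hA : Aᵀ = -A) : symvec A = axl A := by
  have hA' (i j : Fin 3) : A j i = -A i j := congrFun₂ hA i j
  rw [symvec, axl, hA' 2 0]

theorem memLpMat_blocks {B : E3 → Matrix (Fin 3) (Fin 3) M3}
    (hB : ∀ i j, MemLpMat Ω p fun x ↦ B x i j) : MemLpMat Ω p fun x ↦ blocks (B x) :=
  fun _ _ ↦ hB _ _ _ _

theorem memLpMat_zero {m n : ℕ} : MemLpMat Ω p fun _ ↦ (0 : Matrix (Fin m) (Fin n) ℝ) :=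
  fun _ _ ↦ MemLp.zero

theorem MemLpMat.neg {m n : ℕ} {F : E3 → Matrix (Fin m) (Fin n) ℝ} (hF : MemLpMat Ω p F) :
    MemLpMat Ω p fun x ↦ -F x :=
  fun i j ↦ (hF i j).neg

theorem memLpMat_smat {y : E3 → Fin 3 → ℝ} (hy : MemLp y p (volume.restrict Ω)) :
    MemLpMat Ω p fun x ↦ smat (y x) := by
  have zero_memLp : MemLp (fun _ ↦ (0 : ℝ)) p (volume.restrict Ω) := .zero
  intro i j
  fin_cases i <;> fin_cases j
  exacts [zero_memLp, (hy.eval 2).neg, hy.eval 1, hy.eval 2, zero_memLp, (hy.eval 0).neg,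
    (hy.eval 1).neg, hy.eval 0, zero_memLp]

theorem memLpMat_Ldiag (hY : MemLpMat Ω p Y) : MemLpMat Ω p fun x ↦ Ldiag (Y x) := by
  have smat_row (n : Fin 3) := memLpMat_smat (hY.memLp_row n)
  refine (memLpMat_blocks fun i j ↦ ?_).neg
  fin_cases i <;> fin_cases j
  exacts [smat_row 0, memLpMat_zero, memLpMat_zero, memLpMat_zero, smat_row 1, memLpMat_zero,
    memLpMat_zero, memLpMat_zero, smat_row 2]

theorem memLpMat_Lskew (hY : MemLpMat Ω p Y) : MemLpMat Ω p fun x ↦ Lskew (Y x) := by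
  have smat_row (n : Fin 3) := memLpMat_smat (hY.memLp_row n)
  refine memLpMat_blocks fun i j ↦ ?_
  fin_cases i <;> fin_cases j
  exacts [memLpMat_zero, (smat_row 2).neg, smat_row 1, smat_row 2, memLpMat_zero, memLpMat_zero,
    memLpMat_zero, memLpMat_zero, memLpMat_zero]

theorem memLpMat_Lsym (hY : MemLpMat Ω p Y) : MemLpMat Ω p fun x ↦ Lsym (Y x) := by
  have smat_row (n : Fin 3) := memLpMat_smat (hY.memLp_row n)
  refine memLpMat_blocks fun i j ↦ ?_
  fin_cases i <;> fin_cases j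
  exacts [memLpMat_zero, memLpMat_zero, memLpMat_zero, memLpMat_zero, memLpMat_zero,
    (smat_row 0).neg, (smat_row 1).neg, smat_row 0, memLpMat_zero]

theorem memW1_dvec (hX : ∀ i j, MemW1 Ω p fun x ↦ X x i j) (i : Fin 3) :
    MemW1 Ω p fun x ↦ dvec (X x) i := by
  fin_cases i
  exacts [hX 0 0, hX 1 1, hX 2 2]

theorem memW1_skvec (hX : ∀ i j, MemW1 Ω p fun x ↦ X x i j) (i : Fin 3) :
    MemW1 Ω p fun x ↦ skvec (X x) i := by
  fin_cases i
  exacts [(hX 1 2).neg, hX 0 2, (hX 0 1).neg]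

theorem memW1_symvec (hX : ∀ i j, MemW1 Ω p fun x ↦ X x i j) (i : Fin 3) :
    MemW1 Ω p fun x ↦ symvec (X x) i := by
  fin_cases i
  exacts [hX 2 1, (hX 2 0).neg, hX 1 0]

theorem memW1_axl (hX : ∀ i j, MemW1 Ω p fun x ↦ X x i j) (i : Fin 3) :
    MemW1 Ω p fun x ↦ axl (X x) i := by
  fin_cases i
  exacts [hX 2 1, hX 0 2, hX 1 0]

end Formula

section Curl

variable {Ω : Set E3} {p q : ENNReal} {X Y C D K S A : E3 → M3}

theorem hasWeakCurl_mul_of_hasWeakJacobian [p.HolderConjugate q] (hΩ : IsOpen Ω)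
    (hX : ∀ i j, MemW1 Ω q fun x ↦ X x i j) (hY : MemWCurl Ω p Y)
    (hD : HasWeakJacobian Ω (fun x ↦ dvec (X x)) D)
    (hK : HasWeakJacobian Ω (fun x ↦ skvec (X x)) K)
    (hS : HasWeakJacobian Ω (fun x ↦ symvec (X x)) S) (hC : HasWeakCurl Ω Y C) :
    HasWeakCurl Ω (fun x ↦ X x * Y x) fun x ↦
      mat (Ldiag (Y x) *ᵥ vec (D x) + Lskew (Y x) *ᵥ vec (K x) + Lsym (Y x) *ᵥ vec (S x)) +
        X x * C x := by
  simp only [mat_mulVec_vec_eq_sum_cross]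
  exact hasWeakCurl_mul hΩ hX (hasWeakGradient_entryGradient hD hK hS) hY hC

theorem hasWeakCurl_mul_of_transpose_eq_neg [p.HolderConjugate q] (hΩ : IsOpen Ω)
    (hX : ∀ i j, MemW1 Ω q fun x ↦ X x i j) (hY : MemWCurl Ω p Y)
    (hskew : ∀ᵐ x ∂volume.restrict Ω, (X x)ᵀ = -X x)
    (hA : HasWeakJacobian Ω (fun x ↦ axl (X x)) A) (hC : HasWeakCurl Ω Y C) :
    HasWeakCurl Ω (fun x ↦ X x * Y x) fun x ↦ mat (LY (Y x) *ᵥ vec (A x)) + X x * C x := by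
  have jacobian_dvec : HasWeakJacobian Ω (fun x ↦ dvec (X x)) 0 :=
    have jacobian_zero : HasWeakJacobian Ω 0 0 := fun _ _ ↦ hasWeakPartial_zero
    jacobian_zero.congr <| hskew.mono fun _ h ↦ (dvec_eq_zero_of_transpose_eq_neg h).symm
  have jacobian_skvec : HasWeakJacobian Ω (fun x ↦ skvec (X x)) A :=
    hA.congr <| hskew.mono fun _ h ↦ (skvec_eq_axl_of_transpose_eq_neg h).symm
  have jacobian_symvec : HasWeakJacobian Ω (fun x ↦ symvec (X x)) A :=
    hA.congr <| hskew.mono fun _ h ↦ (symvec_eq_axl_of_transpose_eq_neg h).symm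
  have vec_zero : vec 0 = 0 := rfl
  simpa only [Pi.zero_apply, vec_zero, mulVec_zero, zero_add, ← add_mulVec, LY] using
    hasWeakCurl_mul_of_hasWeakJacobian hΩ hX hY jacobian_dvec jacobian_skvec jacobian_symvec hC

end Curl

open scoped Kronecker

section Determinant

variable {R : Type*} [CommRing R]

/-- The matrix of the cross product `x ↦ y ⨯₃ x`; this is `smat` over a commutative ring. -/
def crossMatrix (y : Fin 3 → R) : Matrix (Fin 3) (Fin 3) R := LinearMap.toMatrix' (crossProduct y)

theorem crossMatrix_apply (y : Fin 3 → R) (i j : Fin 3) :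
    crossMatrix y i j = y ⬝ᵥ Pi.single j 1 ⨯₃ Pi.single i 1 := by
  rw [← triple_product_permutation, single_one_dotProduct, crossMatrix, LinearMap.toMatrix'_apply]

theorem mul_crossMatrix_vecMul_mul_transpose (M : Matrix (Fin 3) (Fin 3) R) (y : Fin 3 → R) :
    M * crossMatrix (y ᵥ* M) * Mᵀ = M.det • crossMatrix y := by
  ext i j
  have rows_mul : of ![M i, y ᵥ* M, M j] = of ![Pi.single i 1, y, Pi.single j 1] * M := by
    funext k
    fin_cases k
    exacts [(single_one_vecMul i M).symm, rfl, (single_one_vecMul j M).symm]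
  calc (M * crossMatrix (y ᵥ* M) * Mᵀ) i j = M i ⬝ᵥ (y ᵥ* M) ⨯₃ M j := by
        rw [Matrix.mul_assoc, crossMatrix, ← LinearMap.toMatrix'_mulVec]
        rfl
    _ = (of ![Pi.single i 1, y, Pi.single j 1] * M).det := by
        rw [triple_product_eq_det, ← rows_mul]
        rfl
    _ = (M.det • crossMatrix y) i j := by
        rw [det_mul, Matrix.smul_apply, mul_comm, crossMatrix_apply, ← triple_product_permutation,
          triple_product_eq_det, smul_eq_mul]
        rfl

/-- The block matrix with blocks `∑ₙ (crossMatrix eₙ) i j • crossMatrix (Yₙ)`, where `Yₙ` is the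
`n`-th row of `Y`: this is `L_Y` before `Fin 3 × Fin 3` is identified with `Fin 9`. -/
def crossKronecker (Y : Matrix (Fin 3) (Fin 3) R) : Matrix (Fin 3 × Fin 3) (Fin 3 × Fin 3) R :=
  ∑ n, crossMatrix (Pi.single n 1) ⊗ₖ crossMatrix (Y n)

theorem one_kronecker_mul_crossKronecker_mul (Y M : Matrix (Fin 3) (Fin 3) R) :
    (1 ⊗ₖ M) * crossKronecker (Y * M) * (1 ⊗ₖ Mᵀ) = M.det • crossKronecker Y := by
  simp only [crossKronecker, Finset.mul_sum, Finset.sum_mul, Finset.smul_sum, ← mul_kronecker_mul,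
    one_mul, mul_one, mul_apply_eq_vecMul, mul_crossMatrix_vecMul_mul_transpose, kronecker_smul]

theorem crossKronecker_one_apply (i j a b : Fin 3) :
    crossKronecker (1 : Matrix (Fin 3) (Fin 3) R) (i, a) (j, b) =
      (1 : Matrix _ _ R) j b * (1 : Matrix _ _ R) i a -
        (1 : Matrix _ _ R) j a * (1 : Matrix _ _ R) i b := by
  let e (i : Fin 3) : Fin 3 → R := Pi.single i 1
  have dot_single (i j : Fin 3) : e i ⬝ᵥ e j = (1 : Matrix _ _ R) i j := by
    simp only [e, single_one_dotProduct, one_apply, Pi.single_apply]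
  have one_row (n : Fin 3) : (1 : Matrix (Fin 3) (Fin 3) R) n = Pi.single n 1 :=
    funext fun _ ↦ one_eq_pi_single
  calc crossKronecker 1 (i, a) (j, b) = ∑ n, (e j ⨯₃ e i) n * (e b ⨯₃ e a) n := by
        simp only [crossKronecker, Matrix.sum_apply, kronecker_apply, crossMatrix_apply, one_row,
          single_one_dotProduct, e]
    _ = _ := by
        rw [← dotProduct, cross_dot_cross]
        simp only [dot_single]

theorem det_crossKronecker_one : (crossKronecker (1 : Matrix (Fin 3) (Fin 3) R)).det = -2 := by
  let v (p : Fin 3 × Fin 3) : R := (1 : Matrix _ _ R) p.1 p.2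
  have swap_rows : (crossKronecker 1).submatrix (Equiv.prodComm (Fin 3) (Fin 3)) id =
      -(1 + replicateCol Unit (-v) * replicateRow Unit v) := by
    ext ⟨i, a⟩ ⟨j, b⟩
    rw [← vecMulVec_eq]
    simp only [submatrix_apply, Equiv.prodComm_apply, Prod.swap_prod_mk, id_eq,
      crossKronecker_one_apply, Matrix.neg_apply, Matrix.add_apply, vecMulVec_apply, Pi.neg_apply,
      v, one_apply, Prod.mk.injEq]
    grind
  have sign_swap : Equiv.Perm.sign (Equiv.prodComm (Fin 3) (Fin 3)) = -1 := by decide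
  have det_swap := congrArg det swap_rows
  rw [det_permute, sign_swap, det_neg, det_one_add_replicateCol_mul_replicateRow] at det_swap
  have v_dot_v : v ⬝ᵥ v = 3 := by simp [v, dotProduct, Fintype.sum_prod_type, one_apply]
  rw [dotProduct_neg, v_dot_v] at det_swap
  simp only [Units.val_neg, Units.val_one, Int.cast_neg, Int.cast_one, Fintype.card_prod,
    Fintype.card_fin] at det_swap
  linear_combination -det_swap

theorem ringHom_comp_single_one {ι R S : Type*} [DecidableEq ι] [NonAssocSemiring R]
    [NonAssocSemiring S] (f : R →+* S) (n : ι) : f ∘ (Pi.single n 1 : ι → R) = Pi.single n 1 := by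
  ext k
  rw [Function.comp_apply, Pi.apply_single (fun _ ↦ f) (fun _ ↦ map_zero f), map_one]

theorem map_crossMatrix {S : Type*} [CommRing S] (f : R →+* S) (y : Fin 3 → R) :
    (crossMatrix y).map f = crossMatrix (f ∘ y) := by
  have map_cross (v w : Fin 3 → R) : f ∘ (v ⨯₃ w) = (f ∘ v) ⨯₃ (f ∘ w) := by
    ext k
    fin_cases k <;> simp [cross_apply]
  ext i j
  simp only [map_apply, crossMatrix_apply, RingHom.map_dotProduct, map_cross,
    ringHom_comp_single_one]

theorem mapMatrix_crossKronecker {S : Type*} [CommRing S] (f : R →+* S)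
    (Y : Matrix (Fin 3) (Fin 3) R) :
    f.mapMatrix (crossKronecker Y) = crossKronecker (f.mapMatrix Y) := by
  simp only [crossKronecker, map_sum]
  refine Finset.sum_congr rfl fun n _ ↦ ?_
  change _ = _ ⊗ₖ crossMatrix (f ∘ Y n)
  ext
  rw [← ringHom_comp_single_one f n, ← map_crossMatrix, ← map_crossMatrix]
  exact map_mul f _ _

theorem det_crossKronecker (Y : Matrix (Fin 3) (Fin 3) R) :
    (crossKronecker Y).det = -2 * Y.det ^ 3 := by
  -- `det Y ^ 6` can be cancelled for the matrix of indeterminates, which specialises to `Y`.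
  let X := mvPolynomialX (Fin 3) (Fin 3) ℤ
  have det_X : (crossKronecker X).det = -2 * X.det ^ 3 := by
    have det_mul_eq := congrArg det (one_kronecker_mul_crossKronecker_mul 1 X)
    rw [one_mul, det_mul, det_mul, det_kronecker, det_kronecker, det_smul, det_transpose,
      det_crossKronecker_one] at det_mul_eq
    refine mul_left_cancel₀ (pow_ne_zero 6 (det_mvPolynomialX_ne_zero (Fin 3) ℤ)) ?_
    simp only [det_one, one_pow, one_mul, Fintype.card_prod, Fintype.card_fin,
      mul_neg] at det_mul_eq
    linear_combination det_mul_eq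
  let f : MvPolynomial (Fin 3 × Fin 3) ℤ →+* R :=
    MvPolynomial.eval₂Hom (Int.castRingHom R) fun p ↦ Y p.1 p.2
  have map_X : f.mapMatrix X = Y := mvPolynomialX_map_eval₂ (Int.castRingHom R) Y
  rw [← map_X, ← mapMatrix_crossKronecker, ← RingHom.map_det, det_X,
    ← RingHom.map_det, map_mul, map_pow, map_neg, map_ofNat]

end Determinant

theorem smat_eq_crossMatrix (y : Fin 3 → ℝ) : smat y = crossMatrix y := by
  have toLin_smat : toLin' (smat y) = crossProduct y := LinearMap.ext (smat_mulVec y)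
  rw [crossMatrix, ← toLin_smat, LinearMap.toMatrix'_toLin']

theorem LY_eq_reindex_crossKronecker (Y : M3) :
    LY Y = reindex finProdFinEquiv finProdFinEquiv (crossKronecker Y) := by
  have LY_blocks : LY Y = blocks (of fun i j ↦ ∑ n, smat (Pi.single n 1) i j • smat (Y n)) := by
    have blocks_add (B B' : Matrix (Fin 3) (Fin 3) M3) : blocks B + blocks B' = blocks (B + B') :=
      rfl
    rw [LY, Lskew, Lsym, blocks_add]
    congr 1
    simp only [Fin.sum_univ_three]
    generalize smat (Y 0) = A, smat (Y 1) = B, smat (Y 2) = C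
    ext1 i j
    fin_cases i <;> fin_cases j <;> simp [smat]
  rw [LY_blocks, blocks]
  congr 1
  ext
  simp only [crossKronecker, Matrix.sum_apply, of_apply, ← smat_eq_crossMatrix]
  rfl

theorem det_LY (Y : M3) : (LY Y).det = -2 * Y.det ^ 3 := by
  rw [LY_eq_reindex_crossKronecker, det_reindex_self, det_crossKronecker]

theorem isUnit_LY {Y : M3} (hY : IsUnit Y) : IsUnit (LY Y) := by
  rw [isUnit_iff_isUnit_det, isUnit_iff_ne_zero] at hY ⊢
  rw [det_LY]
  exact mul_ne_zero (by norm_num) (pow_ne_zero 3 hY)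

end NeffCurl

theorem lemma4p1_general (Ω : Set E3) (hΩ : IsOpen Ω) (r s : ENNReal) [s.HolderConjugate r]
    (X Y : E3 → M3) (hX : ∀ i j, MemW1 Ω r (fun x => X x i j)) (hY : MemWCurl Ω s Y) :
    MemWCurl Ω 1 (fun x => X x * Y x) ∧
    MemLpMat Ω s (fun x => Ldiag (Y x)) ∧
    MemLpMat Ω s (fun x => Lskew (Y x)) ∧
    MemLpMat Ω s (fun x => Lsym (Y x)) ∧
    (∀ i, MemW1 Ω r (fun x => dvec (X x) i)) ∧
    (∀ i, MemW1 Ω r (fun x => skvec (X x) i)) ∧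
    (∀ i, MemW1 Ω r (fun x => symvec (X x) i)) ∧
    (∀ D K S C : E3 → M3,
      HasWeakJacobian Ω (fun x => dvec (X x)) D →
      HasWeakJacobian Ω (fun x => skvec (X x)) K →
      HasWeakJacobian Ω (fun x => symvec (X x)) S →
      HasWeakCurl Ω Y C →
      HasWeakCurl Ω (fun x => X x * Y x) (fun x =>
        mat (Matrix.mulVec (Ldiag (Y x)) (vec (D x)) + Matrix.mulVec (Lskew (Y x)) (vec (K x))
          + Matrix.mulVec (Lsym (Y x)) (vec (S x))) + X x * C x)) ∧
    ((∀ᵐ x ∂(volume.restrict Ω), (X x).transpose = -X x) →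
      (∀ i, MemW1 Ω r (fun x => axl (X x) i)) ∧
      ∀ A C : E3 → M3,
        HasWeakJacobian Ω (fun x => axl (X x)) A →
        HasWeakCurl Ω Y C →
        HasWeakCurl Ω (fun x => X x * Y x) (fun x =>
          mat (Matrix.mulVec (LY (Y x)) (vec (A x))) + X x * C x)) ∧
    (∀ M : M3, (LY M).det = -2 * M.det ^ 3) ∧
    (∀ M : M3, IsUnit M → IsUnit (LY M)) := by
  refine ⟨hY.mul hΩ hX, memLpMat_Ldiag hY.1, memLpMat_Lskew hY.1, memLpMat_Lsym hY.1,
    memW1_dvec hX, memW1_skvec hX, memW1_symvec hX, ?_, ?_, det_LY, fun _ ↦ isUnit_LY⟩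
  · exact fun D K S C hD hK hS hC ↦ hasWeakCurl_mul_of_hasWeakJacobian hΩ hX hY hD hK hS hC
  · exact fun hskew ↦ ⟨memW1_axl hX, fun A C hA hC ↦
      hasWeakCurl_mul_of_transpose_eq_neg hΩ hX hY hskew hA hC⟩

theorem lemma4p1 (Ω : Set E3) (hΩ : IsOpen Ω) (r s : ℝ) (hr : 1 < r) (hs : 1 < s)
    (hrs : 1 / r + 1 / s = 1) (X Y : E3 → M3)
    (hX : ∀ i j, MemW1 Ω (ENNReal.ofReal r) (fun x => X x i j))
    (hY : MemWCurl Ω (ENNReal.ofReal s) Y) :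
    -- `XY` lies in `W¹(Curl)`
    MemWCurl Ω 1 (fun x => X x * Y x) ∧
    -- the coefficients are in `Lˢ`
    MemLpMat Ω (ENNReal.ofReal s) (fun x => Ldiag (Y x)) ∧
    MemLpMat Ω (ENNReal.ofReal s) (fun x => Lskew (Y x)) ∧
    MemLpMat Ω (ENNReal.ofReal s) (fun x => Lsym (Y x)) ∧
    -- the vector fields in the formula are weakly differentiable
    (∀ i, MemW1 Ω (ENNReal.ofReal r) (fun x => dvec (X x) i)) ∧
    (∀ i, MemW1 Ω (ENNReal.ofReal r) (fun x => skvec (X x) i)) ∧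
    (∀ i, MemW1 Ω (ENNReal.ofReal r) (fun x => symvec (X x) i)) ∧
    -- the formula for general `X`; `D, K, S` are the weak Jacobians, `C` is `Curl Y`
    (∀ D K S C : E3 → M3,
      HasWeakJacobian Ω (fun x => dvec (X x)) D →
      HasWeakJacobian Ω (fun x => skvec (X x)) K →
      HasWeakJacobian Ω (fun x => symvec (X x)) S →
      HasWeakCurl Ω Y C →
      HasWeakCurl Ω (fun x => X x * Y x) (fun x =>
        mat (Matrix.mulVec (Ldiag (Y x)) (vec (D x)) + Matrix.mulVec (Lskew (Y x)) (vec (K x))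
          + Matrix.mulVec (Lsym (Y x)) (vec (S x))) + X x * C x)) ∧
    -- the formula for skew-symmetric `X`
    ((∀ᵐ x ∂(volume.restrict Ω), (X x).transpose = -X x) →
      (∀ i, MemW1 Ω (ENNReal.ofReal r) (fun x => axl (X x) i)) ∧
      ∀ A C : E3 → M3,
        HasWeakJacobian Ω (fun x => axl (X x)) A →
        HasWeakCurl Ω Y C →
        HasWeakCurl Ω (fun x => X x * Y x) (fun x =>
          mat (Matrix.mulVec (LY (Y x)) (vec (A x))) + X x * C x)) ∧
    -- the determinant and the invertibility of `L_Y`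
    (∀ M : M3, (LY M).det = -2 * M.det ^ 3) ∧
    (∀ M : M3, IsUnit M → IsUnit (LY M)) := by
  have hsr : s.HolderConjugate r := Real.holderConjugate_iff.2 ⟨hs, by
    rw [← hrs, one_div, one_div, add_comm]⟩
  have := hsr.ennrealOfReal
  exact lemma4p1_general Ω hΩ (ENNReal.ofReal r) (ENNReal.ofReal s) X Y hX hY
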